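/- Proposition 4.3 ($c_{00}(\mathbb{C})$ algebrability). Let $c_{00}(\mathbb{C})$ be the space of eventually null complex sequences with the topology induced by the sup norm and coordinatewise operations. Let $m\ge 1$ be an integer, let $\mathcal{A}=\mathcal{C}(\mathbb{R}^m,c_{00}(\mathbb{C}))$ be the (commutative, non-unital) complex algebra of continuous maps $\mathbb{R}^m\to c_{00}(\mathbb{C})$ with pointwise operations, and let $$\mathcal{CS}_\infty(\mathbb{R}^m,c_{00}(\mathbb{C}))=\{f\in\mathcal{A}: f^{-1}(\{a\})\text{ is unbounded for every }a\in c_{00}(\mathbb{C})\}.$$ Call a set $S\subset\mathcal{A}$ algebraically free if $P(x_1,\dots,x_N)\neq 0$ for all distinct $x_1,\dots,x_N\in S$ and every nonzero complex polynomial $P$ in $N$ variables without constant term, and let $\kappa$ be the supremum of the cardinalities of all algebraically free sets $S\subset\mathcal{A}$. Then $\mathcal{CS}_\infty(\mathbb{R}^m,c_{00}(\mathbb{C}))$ is maximal strongly algebrable in $\mathcal{A}$; that is, there is an algebraically free set $S\subset\mathcal{A}$ of cardinality $\kappa$ such that the (non-unital) subalgebra of $\mathcal{A}$ generated by $S$ is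 contained in $\mathcal{CS}_\infty(\mathbb{R}^m,c_{00}(\mathbb{C}))\cup\{0\}$. -/

import Mathlib

open scoped ENNReal

noncomputable section

/-- The value `P(x₁, …, x_N)` of a polynomial `P` without constant term at elements of a commutative
algebra `A` that need not have a unit. It is computed in the unitization `𝕜 ⊕ A`; when the constant
coefficient of `P` is zero, the value lies in the summand `A`. -/
def polyValue {𝕜 A σ : Type*} [Field 𝕜] [NonUnitalCommRing A] [Module 𝕜 A]
    [IsScalarTower 𝕜 A A] [SMulCommClass 𝕜 A A] (x : σ → A) (P : MvPolynomial σ 𝕜) : A :=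
  (MvPolynomial.aeval (fun i => (x i : Unitization 𝕜 A)) P).snd

/-- `S` is an algebraically free system in the (possibly non-unital) commutative algebra `A`:
for any finitely many distinct `x₁, …, x_N ∈ S` and any nonzero polynomial `P` in `N` variables
without constant term, `P(x₁, …, x_N) ≠ 0`. -/
def IsFreeSystem (𝕜 : Type*) {A : Type*} [Field 𝕜] [NonUnitalCommRing A] [Module 𝕜 A]
    [IsScalarTower 𝕜 A A] [SMulCommClass 𝕜 A A] (S : Set A) : Prop :=
  ∀ (N : ℕ) (x : Fin N → A), Function.Injective x → (∀ i, x i ∈ S) →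
    ∀ P : MvPolynomial (Fin N) 𝕜, P ≠ 0 → MvPolynomial.constantCoeff P = 0 → polyValue x P ≠ 0

/-- `B` is strongly `κ`-algebrable: `B ∪ {0}` contains a subalgebra of `A` which is freely generated
by a set of cardinality `κ`. -/
def StronglyAlgebrable (𝕜 : Type*) {A : Type*} [Field 𝕜] [NonUnitalCommRing A] [Module 𝕜 A]
    [IsScalarTower 𝕜 A A] [SMulCommClass 𝕜 A A] (κ : Cardinal) (B : Set A) : Prop :=
  ∃ S : Set A, Cardinal.mk S = κ ∧ IsFreeSystem 𝕜 S ∧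
    (NonUnitalAlgebra.adjoin 𝕜 S : Set A) ⊆ B ∪ {0}

/-- `B` is maximal strongly algebrable in `A`: it is strongly `κ`-algebrable where `κ` is the
supremum of the cardinalities of all algebraically free systems in `A`. (These cardinalities are
bounded by that of `A`, so the supremum is a genuine one.) -/
def MaximalStronglyAlgebrable (𝕜 : Type*) {A : Type*} [Field 𝕜] [NonUnitalCommRing A] [Module 𝕜 A]
    [IsScalarTower 𝕜 A A] [SMulCommClass 𝕜 A A] (B : Set A) : Prop :=
  StronglyAlgebrable 𝕜 (sSup {κ | ∃ S : Set A, IsFreeSystem 𝕜 S ∧ Cardinal.mk S = κ}) B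

/-- The set `CS_∞(ℝ^m, X)` of continuous maps `ℝ^m → X` that take every value on an unbounded
set. -/
def CSInfty (m : ℕ) (X : Type*) [TopologicalSpace X] : Set C(EuclideanSpace ℝ (Fin m), X) :=
  {f | ∀ a : X, ¬ Bornology.IsBounded (f ⁻¹' {a})}

/-- The algebra `c₀₀(ℂ)` of eventually null complex sequences, with pointwise operations and the sup
norm, as a (non-unital) subalgebra of `ℓ^∞(ℂ)`. -/
def c00 : NonUnitalSubalgebra ℂ (lp (fun _ : ℕ => ℂ) ∞) where
  carrier := {x | ∃ n₀ : ℕ, ∀ n ≥ n₀, x n = 0}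
  add_mem' := by
    rintro x y ⟨a, ha⟩ ⟨b, hb⟩
    refine ⟨max a b, fun n hn => ?_⟩
    simp [ha n (le_trans (le_max_left a b) hn), hb n (le_trans (le_max_right a b) hn)]
  zero_mem' := ⟨0, fun n _ => by simp⟩
  mul_mem' := by
    rintro x y ⟨a, ha⟩ ⟨b, hb⟩
    refine ⟨a, fun n hn => ?_⟩
    simp [lp.infty_coeFn_mul, ha n hn]
  smul_mem' := by
    rintro c x ⟨a, ha⟩
    refine ⟨a, fun n hn => ?_⟩
    simp [ha n hn]

end

/-! A map on the separable space `ℝ^m` is determined by countably many values in `c00`, so the whole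
algebra has at most continuum many elements. It therefore suffices to find a free set of that size
inside `CSInfty ∪ {0}`. By `exists_independent_family` there are maps `f i`, `i : ℕ → Bool`, any
finitely many of which take arbitrary prescribed values simultaneously, arbitrarily far out. By
`c00.exists_polyValue_eq` a nonzero `P` without constant term attains every value on `c00`. Hence
`P(f)` takes every value on an unbounded set; in particular it is nonzero, so freeness comes at no
extra cost. -/

open Filter Topology

/-! ### Polynomials without constant term over non-unital algebras -/

section PolyValue

variable {𝕜 A B σ τ : Type*} [Field 𝕜] [NonUnitalCommRing A] [Module 𝕜 A]
    [IsScalarTower 𝕜 A A] [SMulCommClass 𝕜 A A] [NonUnitalCommRing B] [Module 𝕜 B]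
    [IsScalarTower 𝕜 B B] [SMulCommClass 𝕜 B B]

theorem fst_aeval_inr (x : σ → A) (P : MvPolynomial σ 𝕜) :
    (MvPolynomial.aeval (fun i => (x i : Unitization 𝕜 A)) P).fst =
      MvPolynomial.constantCoeff P := by
  have h : (Unitization.fstHom 𝕜 A).comp (MvPolynomial.aeval fun i => (x i : Unitization 𝕜 A)) =
      MvPolynomial.aeval (fun _ => (0 : 𝕜)) := by
    ext i
    simp
  have h' := DFunLike.congr_fun h P
  rw [MvPolynomial.aeval_zero'] at h'
  exact h'

theorem inr_polyValue (x : σ → A) {P : MvPolynomial σ 𝕜}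
    (hP : MvPolynomial.constantCoeff P = 0) :
    ((polyValue x P : A) : Unitization 𝕜 A) =
      MvPolynomial.aeval (fun i => (x i : Unitization 𝕜 A)) P := by
  ext
  · simp [fst_aeval_inr, hP]
  · simp [polyValue]

theorem polyValue_rename (f : τ → A) (g : σ → τ) (P : MvPolynomial σ 𝕜) :
    polyValue f (MvPolynomial.rename g P) = polyValue (f ∘ g) P := by
  simp [polyValue, MvPolynomial.aeval_rename, Function.comp_def]

theorem polyValue_congr {x y : σ → A} {P : MvPolynomial σ 𝕜} (h : ∀ i ∈ P.vars, x i = y i) :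
    polyValue x P = polyValue y P := by
  refine congrArg (fun z : Unitization 𝕜 A => z.snd) (MvPolynomial.eval₂Hom_congr' rfl (fun i hi _ => ?_) rfl)
  rw [h i hi]

/-- Reduces `c00` to its coordinates and function algebras to point evaluations. -/
theorem map_polyValue (φ : A →ₙₐ[𝕜] B) (x : σ → A) {P : MvPolynomial σ 𝕜}
    (hP : MvPolynomial.constantCoeff P = 0) :
    φ (polyValue x P) = polyValue (fun i => φ (x i)) P := by
  have h : (Unitization.lift ((Unitization.inrNonUnitalAlgHom 𝕜 B).comp φ)).comp
      (MvPolynomial.aeval fun i => (x i : Unitization 𝕜 A)) =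
        MvPolynomial.aeval (fun i => (φ (x i) : Unitization 𝕜 B)) := by
    ext i <;> simp
  have h' := congrArg (fun z : Unitization 𝕜 B => z.snd) (DFunLike.congr_fun h P)
  rw [AlgHom.comp_apply, ← inr_polyValue x hP] at h'
  simpa [polyValue] using h'

theorem polyValue_eq_eval (x : σ → 𝕜) {P : MvPolynomial σ 𝕜}
    (hP : MvPolynomial.constantCoeff P = 0) : polyValue x P = MvPolynomial.eval x P := by
  have h : (Unitization.lift (NonUnitalAlgHom.id 𝕜 𝕜)).comp
      (MvPolynomial.aeval fun i => (x i : Unitization 𝕜 𝕜)) = MvPolynomial.aeval x := by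
    ext i
    simp
  have h' := DFunLike.congr_fun h P
  rw [AlgHom.comp_apply, ← inr_polyValue x hP] at h'
  simpa [MvPolynomial.aeval_eq_eval] using h'

/-- Every element of the subalgebra generated by a family is a polynomial without constant term
in that family. -/
theorem exists_polyValue_of_mem_adjoin (f : σ → A) {y : A}
    (hy : y ∈ NonUnitalAlgebra.adjoin 𝕜 (Set.range f)) :
    ∃ P : MvPolynomial σ 𝕜, MvPolynomial.constantCoeff P = 0 ∧ polyValue f P = y := by
  induction hy using NonUnitalAlgebra.adjoin_induction with
  | mem x hx =>
    obtain ⟨i, rfl⟩ := hx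
    exact ⟨MvPolynomial.X i, by simp, by simp [polyValue]⟩
  | zero => exact ⟨0, by simp, by simp [polyValue]⟩
  | add x y _ _ hx hy =>
    obtain ⟨P, hP, rfl⟩ := hx
    obtain ⟨Q, hQ, rfl⟩ := hy
    exact ⟨P + Q, by simp [hP, hQ], by simp [polyValue]⟩
  | mul x y _ _ hx hy =>
    obtain ⟨P, hP, rfl⟩ := hx
    obtain ⟨Q, hQ, rfl⟩ := hy
    exact ⟨P * Q, by simp [hP], by simp [polyValue, fst_aeval_inr, hP, hQ]⟩
  | smul r x _ hx =>
    obtain ⟨P, hP, rfl⟩ := hx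
    exact ⟨r • P, by simp [hP], by simp [polyValue]⟩

/-- Restricted to the line through `0` and a point `u` with `P(u) ≠ 0`, `P` becomes a nonconstant
polynomial in one variable, which is surjective over an algebraically closed field. -/
theorem exists_eval_eq_of_constantCoeff_eq_zero [IsAlgClosed 𝕜] {P : MvPolynomial σ 𝕜}
    (hP : P ≠ 0) (h0 : MvPolynomial.constantCoeff P = 0) (c : 𝕜) :
    ∃ w : σ → 𝕜, MvPolynomial.eval w P = c := by
  have : Infinite 𝕜 := IsAlgClosed.instInfinite
  obtain ⟨u, hu⟩ : ∃ u : σ → 𝕜, MvPolynomial.eval u P ≠ 0 := by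
    by_contra! h
    exact hP (MvPolynomial.funext fun x => by simpa using h x)
  set Q : Polynomial 𝕜 :=
    MvPolynomial.aeval (fun i => Polynomial.C (u i) * Polynomial.X) P with hQ
  have heval (t : 𝕜) : Q.eval t = MvPolynomial.eval (fun i => u i * t) P := by
    rw [hQ, ← Polynomial.coe_aeval_eq_eval, ← MvPolynomial.aeval_eq_eval]
    change ((Polynomial.aeval t).comp (MvPolynomial.aeval _)) P = MvPolynomial.aeval _ P
    congr 1
    ext i
    simp
  have hdeg : (Q - Polynomial.C c).degree ≠ 0 := by
    intro hd
    have h1 := Polynomial.eq_C_of_degree_eq_zero hd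
    have e0 : Q.eval 0 = 0 := by
      rw [heval]
      simp only [mul_zero]
      change MvPolynomial.eval (0 : σ → 𝕜) P = 0
      rw [MvPolynomial.eval_zero, h0]
    have e1 : Q.eval 1 ≠ 0 := by simpa [heval] using hu
    have a0 := congrArg (Polynomial.eval 0) h1
    have a1 := congrArg (Polynomial.eval 1) h1
    simp only [Polynomial.eval_sub, Polynomial.eval_C] at a0 a1
    exact e1 (by rw [← e0]; exact sub_left_injective (a1.trans a0.symm))
  obtain ⟨t, ht⟩ := IsAlgClosed.exists_root _ hdeg
  refine ⟨fun i => u i * t, ?_⟩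
  rw [← heval]
  simpa [sub_eq_zero] using ht

end PolyValue

/-! ### Space-filling curves -/

section SpaceFilling

/-- A compactly supported curve passing through all points of a given ball. -/
theorem exists_continuous_curve_through_closedBall (ι : Type) [Fintype ι] (r : ℝ) (hr : 0 ≤ r) :
    ∃ g : ℝ → ι → ℂ, Continuous g ∧ (∀ t, 2 ≤ |t| → g t = 0) ∧
      ∀ v : ι → ℂ, ‖v‖ ≤ r → ∃ t ∈ Set.Icc (0 : ℝ) 1, g t = v := by
  have : Nonempty (Metric.closedBall (0 : ι → ℂ) r) := ⟨⟨0, by simpa using hr⟩⟩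
  have : CompactSpace (Metric.closedBall (0 : ι → ℂ) r) :=
    isCompact_iff_compactSpace.mp (isCompact_closedBall _ _)
  -- A nonempty compact metric space is a continuous image of the Cantor set; Tietze extends this
  -- surjection from the Cantor set to the line.
  obtain ⟨f, hf, hsurj⟩ :=
    exists_nat_bool_continuous_surjective_of_compact (Metric.closedBall (0 : ι → ℂ) r)
  let e : (ℕ → Bool) → ℝ := fun b => (cantorSetHomeomorphNatToBool.symm b : ℝ)
  have he : IsClosedEmbedding e :=
    (continuous_subtype_val.comp cantorSetHomeomorphNatToBool.symm.continuous).isClosedEmbedding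
      (Subtype.val_injective.comp cantorSetHomeomorphNatToBool.symm.injective)
  obtain ⟨p, hp⟩ := ContinuousMap.exists_extension he
    (⟨fun b => (f b : ι → ℂ), continuous_subtype_val.comp hf⟩ : C(ℕ → Bool, ι → ℂ))
  -- The cutoff is `1` on `[0, 1]`, which contains the Cantor set, and vanishes for `|t| ≥ 2`.
  refine ⟨fun t => (max 0 (min 1 (2 - |t|)) : ℝ) • p t, by fun_prop, fun t ht => ?_,
    fun v hv => ?_⟩
  · have : max 0 (min 1 (2 - |t|)) = 0 :=
      max_eq_left ((min_le_right _ _).trans (by linarith))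
    simp [this]
  · obtain ⟨b, hb⟩ := hsurj ⟨v, by simpa using hv⟩
    have hmem : e b ∈ Set.Icc (0 : ℝ) 1 :=
      cantorSet_subset_unitInterval (cantorSetHomeomorphNatToBool.symm b).2
    refine ⟨e b, hmem, ?_⟩
    have h1 : max 0 (min 1 (2 - |e b|)) = 1 := by
      rw [abs_of_nonneg hmem.1, min_eq_left (by linarith [hmem.2])]
      norm_num
    have h2 : p (e b) = f b := DFunLike.congr_fun hp b
    simp only [h1, h2, hb, one_smul]

end SpaceFilling

/-! ### The algebra of eventually null sequences -/

namespace c00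

theorem coe_injective : Function.Injective fun (a : c00) (k : ℕ) => (a : lp (fun _ : ℕ => ℂ) ∞) k :=
  fun _ _ h => Subtype.ext (lp.ext h)

theorem memℓp_dite (n : ℕ) (v : Fin n → ℂ) :
    Memℓp (fun k : ℕ => if h : k < n then v ⟨k, h⟩ else (0 : ℂ)) ∞ := by
  refine (memℓp_zero ((Set.finite_lt_nat n).subset fun k hk => ?_)).of_exponent_ge zero_le
  by_contra h
  exact hk (dif_neg h)

/-- The finitely supported bounded sequence with given initial terms. -/
noncomputable def ofFinLp (n : ℕ) : (Fin n → ℂ) →ₗ[ℂ] lp (fun _ : ℕ => ℂ) ∞ where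
  toFun v := ⟨_, memℓp_dite n v⟩
  map_add' v w := by
    ext k
    change (if h : k < n then v ⟨k, h⟩ + w ⟨k, h⟩ else 0) =
      (if h : k < n then v ⟨k, h⟩ else 0) + if h : k < n then w ⟨k, h⟩ else 0
    split_ifs <;> simp
  map_smul' c v := by
    ext k
    change (if h : k < n then c * v ⟨k, h⟩ else 0) = c * if h : k < n then v ⟨k, h⟩ else 0
    split_ifs <;> simp

/-- The finitely supported sequence with given initial terms. -/
noncomputable def ofFin (n : ℕ) (v : Fin n → ℂ) : c00 :=
  ⟨ofFinLp n v, n, fun _ hk => dif_neg hk.not_gt⟩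

theorem ofFin_zero (n : ℕ) : ofFin n 0 = 0 :=
  Subtype.ext (map_zero (ofFinLp n))

theorem ofFin_apply (n : ℕ) (v : Fin n → ℂ) (k : ℕ) :
    (ofFin n v : lp (fun _ : ℕ => ℂ) ∞) k = if h : k < n then v ⟨k, h⟩ else 0 := rfl

theorem ofFin_eq (n : ℕ) (a : c00) (h : ∀ k ≥ n, (a : lp (fun _ : ℕ => ℂ) ∞) k = 0) :
    ofFin n (fun k => (a : lp (fun _ : ℕ => ℂ) ∞) k) = a := by
  apply coe_injective
  funext k
  simp only [ofFin_apply]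
  split_ifs with hk
  · rfl
  · exact (h k (not_lt.mp hk)).symm

theorem continuous_ofFin (n : ℕ) : Continuous (ofFin n) :=
  (LinearMap.continuous_of_finiteDimensional (ofFinLp n)).subtype_mk _

/-- The coordinate functionals. -/
noncomputable def coord (k : ℕ) : c00 →ₙₐ[ℂ] ℂ where
  toFun a := (a : lp (fun _ : ℕ => ℂ) ∞) k
  map_smul' _ _ := rfl
  map_zero' := rfl
  map_add' _ _ := rfl
  map_mul' a b := by simp [lp.infty_coeFn_mul]

theorem coord_apply (k : ℕ) (a : c00) : coord k a = (a : lp (fun _ : ℕ => ℂ) ∞) k := rfl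

theorem coord_ofFin (n : ℕ) (v : Fin n → ℂ) (k : ℕ) :
    coord k (ofFin n v) = if h : k < n then v ⟨k, h⟩ else 0 := rfl

theorem ext_coord {a b : c00} (h : ∀ k, coord k a = coord k b) : a = b :=
  coe_injective (funext h)

theorem norm_coord_le (k : ℕ) (a : c00) : ‖coord k a‖ ≤ ‖a‖ :=
  lp.norm_apply_le_norm ENNReal.top_ne_zero _ k

instance : Nontrivial c00 :=
  ⟨ofFin 1 1, 0, fun h => by simpa [coord_ofFin] using congrArg (coord 0) h⟩

theorem mk_le : Cardinal.mk c00 ≤ Cardinal.continuum := by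
  calc Cardinal.mk c00 ≤ Cardinal.mk (ℕ → ℂ) := Cardinal.mk_le_of_injective coe_injective
    _ = Cardinal.continuum := by simp

/-- A polynomial without constant term in finitely many variables takes every value in `c00`. -/
theorem exists_polyValue_eq {σ : Type*} {P : MvPolynomial σ ℂ}
    (hP : P ≠ 0) (h0 : MvPolynomial.constantCoeff P = 0) (a : c00) :
    ∃ w : σ → c00, polyValue w P = a := by
  obtain ⟨n, hn⟩ := a.2
  -- The equation is solved coordinatewise. Beyond `n` the solution is cut to `0`, which is
  -- consistent because `P(0) = 0`; this keeps `w` in `c00`.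
  choose u hu using fun k : ℕ => exists_eval_eq_of_constantCoeff_eq_zero hP h0 (coord k a)
  refine ⟨fun i => ofFin n fun k => u k i, ext_coord fun k => ?_⟩
  refine ((map_polyValue (𝕜 := ℂ) (A := c00) (coord k) _ h0).trans (polyValue_eq_eval _ h0)).trans ?_
  simp only [coord_ofFin]
  by_cases hk : k < n
  · simpa [hk] using hu k
  · rw [coord_apply, hn k (not_lt.mp hk)]
    simp only [hk, dite_false]
    change MvPolynomial.eval (0 : σ → ℂ) P = 0
    rw [MvPolynomial.eval_zero, h0]

end c00

/-! ### The independent family -/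

/-- There are continuum many continuous maps `E → c00` such that any finitely many of them take
arbitrary prescribed values simultaneously, arbitrarily far from the origin. -/
theorem exists_independent_family (E : Type*) [NormedAddCommGroup E] [NormedSpace ℝ E]
    [Nontrivial E] :
    ∃ f : (ℕ → Bool) → C(E, c00), ∀ (s : Finset (ℕ → Bool)) (w : (ℕ → Bool) → c00) (r : ℝ),
      ∃ x, r ≤ ‖x‖ ∧ ∀ i ∈ s, f i x = w i := by
  choose g hg hsupp hball using fun n : ℕ =>
    exists_continuous_curve_through_closedBall ((Fin n → Bool) × Fin n) n n.cast_nonneg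
  -- Near radius `4n`, the map of index `i` reads the block of the `n`-th curve labelled by the
  -- first `n` bits of `i`. The curve lives on `(-2, 2)`, so spacing `4` keeps the shells disjoint.
  let F (i : ℕ → Bool) (n : ℕ) (x : E) : c00 :=
    c00.ofFin n fun k => g n (‖x‖ - 4 * n) (fun j => i j, k)
  have hF0 (i : ℕ → Bool) (n : ℕ) (x : E) (h : 2 ≤ |‖x‖ - 4 * n|) : F i n x = 0 := by
    simp only [F, hsupp n _ h]
    exact c00.ofFin_zero n
  have hFc (i : ℕ → Bool) (n : ℕ) : Continuous (F i n) := by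
    refine (c00.continuous_ofFin n).comp (continuous_pi fun k => ?_)
    exact (continuous_apply _).comp ((hg n).comp (by fun_prop))
  have hlf (i : ℕ → Bool) : LocallyFinite fun n => Function.support (F i n) := by
    intro x
    refine ⟨Metric.ball x 1, Metric.ball_mem_nhds x one_pos, ?_⟩
    obtain ⟨N, hN⟩ := exists_nat_ge (‖x‖ + 3)
    refine (Set.finite_lt_nat N).subset ?_
    rintro n ⟨y, hy, hyx⟩
    by_contra hn
    refine hy (hF0 i n y ?_)
    have h1 : ‖y‖ ≤ ‖x‖ + 1 := by
      have := norm_le_norm_add_norm_sub' y x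
      rw [Metric.mem_ball, dist_eq_norm] at hyx
      linarith
    have h2 : (N : ℝ) ≤ n := by exact_mod_cast not_lt.mp hn
    rw [abs_of_nonpos (by linarith [norm_nonneg x])]
    linarith [norm_nonneg x]
  refine ⟨fun i => ⟨fun x => ∑ᶠ n, F i n x, continuous_finsum (hFc i) (hlf i)⟩, fun s w r => ?_⟩
  -- For large `n` the first `n` bits separate `s`, and the targets fit in `n` coordinates and in
  -- the ball of radius `n`.
  have key : ∀ᶠ n : ℕ in atTop, (∀ i ∈ s, ∀ j ∈ s, (∀ k : Fin n, i k = j k) → i = j) ∧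
      (∀ i ∈ s, ∀ k ≥ n, (w i : lp (fun _ : ℕ => ℂ) ∞) k = 0) ∧ (∀ i ∈ s, ‖w i‖ ≤ n) ∧
      r ≤ 4 * n := by
    refine .and ?_ (.and ?_ (.and ?_ ?_))
    · refine (eventually_all_finset s).2 fun i _ => (eventually_all_finset s).2 fun j _ => ?_
      by_cases hij : i = j
      · simp [hij]
      · obtain ⟨k, hk⟩ := Function.ne_iff.mp hij
        filter_upwards [eventually_gt_atTop k] with n hn h
        exact absurd (h ⟨k, hn⟩) hk
    · refine (eventually_all_finset s).2 fun i _ => ?_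
      obtain ⟨N, hN⟩ := (w i).2
      filter_upwards [eventually_ge_atTop N] with n hn k hk using hN k (hn.trans hk)
    · exact (eventually_all_finset s).2 fun i _ =>
        tendsto_natCast_atTop_atTop.eventually_ge_atTop _
    · filter_upwards [tendsto_natCast_atTop_atTop.eventually_ge_atTop (r / 4)] with n hn
      linarith
  obtain ⟨n, hinj, hzero, hnorm, hr⟩ := key.exists
  classical
  -- All targets are packed into a single point of the ball, with `0` in the blocks that `s` does
  -- not use.
  let v : (Fin n → Bool) × Fin n → ℂ := fun p =>
    if h : ∃ i ∈ s, (fun j : Fin n => i j) = p.1 then c00.coord p.2 (w h.choose) else 0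
  have hv (i) (hi : i ∈ s) (k : Fin n) : v (fun j => i j, k) = c00.coord k (w i) := by
    have h : ∃ i' ∈ s, (fun j : Fin n => i' j) = fun j : Fin n => i j := ⟨i, hi, rfl⟩
    have h' : h.choose = i :=
      hinj _ h.choose_spec.1 i hi fun k => congrFun h.choose_spec.2 k
    simp only [v, dif_pos h, h']
  have hvn : ‖v‖ ≤ n := by
    refine (pi_norm_le_iff_of_nonneg n.cast_nonneg).2 fun p => ?_
    by_cases h : ∃ i ∈ s, (fun j : Fin n => i j) = p.1
    · simp only [v, dif_pos h]
      exact (c00.norm_coord_le _ _).trans (hnorm _ h.choose_spec.1)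
    · simp [v, dif_neg h]
  obtain ⟨t, ht, hgt⟩ := hball n v hvn
  obtain ⟨x, hx⟩ := exists_norm_eq E (c := 4 * n + t) (by linarith [ht.1, n.cast_nonneg (α := ℝ)])
  refine ⟨x, by linarith [ht.1], fun i hi => ?_⟩
  change ∑ᶠ n, F i n x = w i
  rw [finsum_eq_single _ n fun q hq => hF0 i q x ?_]
  · simp only [F, hx, add_sub_cancel_left, hgt, hv i hi]
    exact c00.ofFin_eq n (w i) (hzero i hi)
  · rw [hx, le_abs]
    rcases lt_or_gt_of_ne hq with h | h
    · left
      have : (q : ℝ) + 1 ≤ n := by exact_mod_cast h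
      linarith [ht.1]
    · right
      have : (n : ℝ) + 1 ≤ q := by exact_mod_cast h
      linarith [ht.2]

/-! ### Cardinality bound and maximal algebrability -/

section ContinuousMap

theorem mk_continuousMap_le (E X : Type) [TopologicalSpace E] [TopologicalSpace X] [T2Space X]
    [TopologicalSpace.SeparableSpace E] (hX : Cardinal.mk X ≤ Cardinal.continuum) :
    Cardinal.mk C(E, X) ≤ Cardinal.continuum := by
  obtain ⟨D, hDc, hD⟩ := TopologicalSpace.exists_countable_dense E
  have hinj : Function.Injective fun (f : C(E, X)) (d : D) => f d := fun f g h =>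
    ContinuousMap.ext <| congrFun <| f.continuous.ext_on hD g.continuous
      fun d hd => congrFun h ⟨d, hd⟩
  calc Cardinal.mk C(E, X) ≤ Cardinal.mk (D → X) := Cardinal.mk_le_of_injective hinj
    _ = Cardinal.mk X ^ Cardinal.mk D := by simp
    _ ≤ Cardinal.continuum ^ Cardinal.mk D := Cardinal.power_le_power_right hX
    _ ≤ Cardinal.continuum ^ Cardinal.aleph0 :=
      Cardinal.power_le_power_left Cardinal.continuum_ne_zero (Cardinal.mk_le_aleph0_iff.2 hDc)
    _ = Cardinal.continuum := Cardinal.continuum_power_aleph0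

theorem zero_notMem_CSInfty {X : Type*} [TopologicalSpace X] [Zero X]
    [Nontrivial X] (m : ℕ) :
    (0 : C(EuclideanSpace ℝ (Fin m), X)) ∉ CSInfty m X := by
  intro h
  obtain ⟨a, ha⟩ := exists_ne (0 : X)
  refine h a ?_
  convert Bornology.isBounded_empty
  ext x
  simpa using ha.symm

variable {𝕜 X : Type*} [Field 𝕜] [TopologicalSpace X] [NonUnitalCommRing X]
  [IsTopologicalRing X] [Module 𝕜 X] [ContinuousConstSMul 𝕜 X] [IsScalarTower 𝕜 X X]
  [SMulCommClass 𝕜 X X]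

variable (𝕜) in
/-- Evaluation at a point as a non-unital algebra homomorphism. -/
def evalNonUnitalAlgHom {E : Type*} [TopologicalSpace E] (x : E) : C(E, X) →ₙₐ[𝕜] X where
  toFun f := f x
  map_smul' _ _ := rfl
  map_zero' := rfl
  map_add' _ _ := rfl
  map_mul' _ _ := rfl

theorem polyValue_mem_CSInfty {m : ℕ} {σ : Type*} {f : σ → C(EuclideanSpace ℝ (Fin m), X)}
    (hf : ∀ (s : Finset σ) (w : σ → X) (r : ℝ), ∃ x, r ≤ ‖x‖ ∧ ∀ i ∈ s, f i x = w i)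
    {P : MvPolynomial σ 𝕜} (h0 : MvPolynomial.constantCoeff P = 0)
    (hP : ∀ a : X, ∃ w : σ → X, polyValue w P = a) :
    polyValue f P ∈ CSInfty m X := by
  intro a hb
  obtain ⟨R, hR⟩ := hb.exists_norm_le
  obtain ⟨w, hw⟩ := hP a
  -- Only the finitely many variables occurring in `P` need prescribed values.
  obtain ⟨x, hx, hxw⟩ := hf P.vars w (R + 1)
  have hmem : polyValue f P x = a := by
    rw [← hw, ← polyValue_congr hxw]
    exact map_polyValue (evalNonUnitalAlgHom 𝕜 x) f h0
  linarith [hR x hmem]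

/-- An independent family of continuum many continuous maps into an algebra `X` of cardinality at
most the continuum generates a free algebra inside `CSInfty m X ∪ {0}`, provided that nonzero
polynomials without constant term are surjective on `X`. -/
theorem maximalStronglyAlgebrable_CSInfty {X : Type} [TopologicalSpace X] [T2Space X]
    [Nontrivial X] [NonUnitalCommRing X] [IsTopologicalRing X] [Module 𝕜 X]
    [ContinuousConstSMul 𝕜 X] [IsScalarTower 𝕜 X X] [SMulCommClass 𝕜 X X] (m : ℕ)
    (hX : Cardinal.mk X ≤ Cardinal.continuum)
    (hsolve : ∀ P : MvPolynomial (ℕ → Bool) 𝕜, P ≠ 0 → MvPolynomial.constantCoeff P = 0 →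
      ∀ a : X, ∃ w : (ℕ → Bool) → X, polyValue w P = a)
    {f : (ℕ → Bool) → C(EuclideanSpace ℝ (Fin m), X)}
    (hf : ∀ (s : Finset (ℕ → Bool)) (w : (ℕ → Bool) → X) (r : ℝ),
      ∃ x, r ≤ ‖x‖ ∧ ∀ i ∈ s, f i x = w i) :
    MaximalStronglyAlgebrable 𝕜 (CSInfty m X) := by
  have hinj : Function.Injective f := by
    intro i j hij
    by_contra hne
    obtain ⟨a, ha⟩ := exists_ne (0 : X)
    classical
    obtain ⟨x, -, hx⟩ := hf {i, j} (fun l => if l = i then a else 0) 0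
    have hi := hx i (by simp)
    have hj := hx j (by simp)
    rw [if_pos rfl] at hi
    rw [if_neg (Ne.symm hne), ← hij, hi] at hj
    exact ha hj
  have hfree : IsFreeSystem 𝕜 (Set.range f) := by
    intro N x hx hxS P hP h0
    choose g hg using hxS
    have hgx : f ∘ g = x := funext hg
    have hginj : Function.Injective g := Function.Injective.of_comp (f := f) (hgx ▸ hx)
    have h0' : MvPolynomial.constantCoeff (MvPolynomial.rename g P) = 0 := by simpa using h0
    have hP' : MvPolynomial.rename g P ≠ 0 := by
      simpa using (MvPolynomial.rename_injective g hginj).ne hP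
    rw [← hgx, ← polyValue_rename]
    have hmem := polyValue_mem_CSInfty hf h0' (hsolve _ hP' h0')
    exact fun h => zero_notMem_CSInfty m (h ▸ hmem)
  have hcard : Cardinal.mk (Set.range f) = Cardinal.continuum := by
    rw [Cardinal.mk_range_eq f hinj]
    simp
  refine ⟨Set.range f, le_antisymm ?_ ?_, hfree, ?_⟩
  · refine le_csSup ⟨Cardinal.mk C(EuclideanSpace ℝ (Fin m), X), ?_⟩ ⟨_, hfree, rfl⟩
    rintro _ ⟨S, -, rfl⟩
    exact Cardinal.mk_set_le S
  · rw [hcard]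
    refine csSup_le' ?_
    rintro _ ⟨S, -, rfl⟩
    exact (Cardinal.mk_set_le S).trans (mk_continuousMap_le _ _ hX)
  · intro y hy
    obtain ⟨P, h0, rfl⟩ := exists_polyValue_of_mem_adjoin f hy
    by_cases hP : P = 0
    · right
      simp [hP, polyValue]
    · exact Or.inl (polyValue_mem_CSInfty hf h0 (hsolve P hP h0))

end ContinuousMap

theorem proposition4p3 (m : ℕ) (hm : 1 ≤ m) :
    MaximalStronglyAlgebrable ℂ (CSInfty m c00) := by
  -- This makes the Euclidean space nontrivial, so that it has vectors of every norm.
  have : Nonempty (Fin m) := ⟨⟨0, hm⟩⟩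
  obtain ⟨f, hf⟩ := exists_independent_family (EuclideanSpace ℝ (Fin m))
  exact maximalStronglyAlgebrable_CSInfty m c00.mk_le
    (fun _ hP h0 a => c00.exists_polyValue_eq hP h0 a) hf
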